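/- Let $A$ be a complex $C^*$-algebra (not assumed unital), and call $u\in A$ an extremal partial isometry if it is an extreme point of the closed unit ball $\{a\in A:\|a\|\le 1\}$ (such a $u$ is automatically a partial isometry, i.e. $uu^*u=u$). If $u,v\in A$ are extremal partial isometries with $\|u-v\|<2$, then $A$ is necessarily unital, and $u$ and $v$ are homotopic through extremal partial isometries in $A$: there is a norm-continuous map $\gamma:[0,1]\to A$ with $\gamma(0)=u$, $\gamma(1)=v$ such that each $\gamma(t)$ is a partial isometry and an extreme point of the closed unit ball of $A$. The constant $2$ is sharp: there are a unital $C^*$-algebra $B$ and extremal partial isometries $u,v\in B$ with $\|u-v\|=2$ which are not homotopic through extremal partial isometries in $B$. -/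

import Mathlib

universe w

/-- `u` is a partial isometry in a C⋆-algebra: `u u* u = u`. -/
def IsPartialIsometry {A : Type*} [NonUnitalCStarAlgebra A] (u : A) : Prop :=
  u * star u * u = u

/-- The extreme points of the closed unit ball of `A`. -/
def unitBallExtremePoints (A : Type*) [NonUnitalCStarAlgebra A] : Set A :=
  Set.extremePoints ℝ (Metric.closedBall (0 : A) 1)

/-- The extremal partial isometries of `A`: the partial isometries that are extreme points of the
closed unit ball of `A`. -/
def extremalPartialIsometries (A : Type*) [NonUnitalCStarAlgebra A] : Set A :=
  {u | IsPartialIsometry u ∧ u ∈ unitBallExtremePoints A}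

/-! By Kadison, `u` is extreme iff it is a partial isometry with `(1 - u u*) A (1 - u* u) = 0`.
Feeding an approximate unit into this relation produces a unit. If `‖x - u‖ ≤ r < 1`, then `x` has a
quasi-inverse `y`, with `(1 - x y) B (1 - y x) = 0` and `‖y‖` bounded in terms of `r`
(`exists_quasiInverse`). So the spectrum of `x* x` avoids `(0, δ)` for some `δ` depending only on
`r` (`spectrum_gap_of_eq_mul_mul`), and the polar part of `x` is extremal and norm-continuous in
`x`. When `‖u - v‖ < 2`, every point of the segment from `u` to `v` is within `‖u - v‖ / 2 < 1` of
an endpoint, so polar parts along the segment give the homotopy. For sharpness, unitaries are clopen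
among extremal partial isometries, so `1` is not joined to a proper isometry. -/

section Unital

/-! ### Norm estimates and the sufficient half of Kadison's criterion. -/

variable {B : Type*} [CStarAlgebra B]

lemma star_mul_cfc_mul_mul_cfc (x : B) {f g : ℝ → ℝ} (hf : Continuous f) (hg : Continuous g) :
    star (x * cfc f (star x * x)) * (x * cfc g (star x * x)) =
      cfc (fun s ↦ f s * (s * g s)) (star x * x) := by
  have ha : IsSelfAdjoint (star x * x) := .star_mul_self x
  rw [cfc_mul f (fun s ↦ s * g s) _ hf.continuousOn (by fun_prop),
    cfc_mul (fun s ↦ s) g _ (by fun_prop) hg.continuousOn, cfc_id' ℝ _ ha, star_mul,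
    (cfc_predicate f (star x * x)).star_eq]
  simp only [mul_assoc]

/-- The value at `0` is irrelevant: the difference `z` has `z* z` given by `s (f s - g s)²`. -/
lemma mul_cfc_congr (x : B) {f g : ℝ → ℝ} (hf : Continuous f) (hg : Continuous g)
    (h : ∀ s ∈ spectrum ℝ (star x * x), s ≠ 0 → f s = g s) :
    x * cfc f (star x * x) = x * cfc g (star x * x) := by
  rw [← sub_eq_zero, ← mul_sub, ← cfc_sub f g _ hf.continuousOn hg.continuousOn,
    ← CStarRing.star_mul_self_eq_zero_iff,
    star_mul_cfc_mul_mul_cfc x (f := fun s ↦ f s - g s) (g := fun s ↦ f s - g s) (hf.sub hg)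
      (hf.sub hg), ← cfc_const_zero ℝ (star x * x)]
  refine cfc_congr fun s hs ↦ ?_
  by_cases h0 : s = 0
  · simp [h0]
  · simp [h s hs h0]

lemma nonneg_of_mem_spectrum_star_mul_self (x : B) {s : ℝ} (hs : s ∈ spectrum ℝ (star x * x)) :
    0 ≤ s := by
  let _ := CStarAlgebra.spectralOrder B
  let _ := CStarAlgebra.spectralOrderedRing B
  exact spectrum_nonneg_of_nonneg (star_mul_self_nonneg x) hs

lemma norm_mul_cfc_le_one (x : B) {f : ℝ → ℝ} (hf : Continuous f)
    (h : ∀ s ∈ spectrum ℝ (star x * x), |f s * (s * f s)| ≤ 1) :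
    ‖x * cfc f (star x * x)‖ ≤ 1 := by
  have := CStarRing.norm_star_mul_self (x := x * cfc f (star x * x))
  rw [star_mul_cfc_mul_mul_cfc x hf hf] at this
  have h2 := norm_cfc_le (𝕜 := ℝ) (f := fun s ↦ f s * (s * f s)) (a := star x * x) zero_le_one h
  nlinarith [norm_nonneg (x * cfc f (star x * x))]

/-- With `t = √s`, the bound is `t (1 + (t² - t⁴) / 2) ≤ 1` on `[0, 1]`. Both signs of `c` are
allowed, so extremality will kill the perturbation. -/
lemma norm_add_mul_sub_sq_le_one {u : B} (hu : ‖u‖ ≤ 1) {c : ℝ} (hc : |c| ≤ 1 / 2) :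
    ‖u + c • (u * (star u * u - star u * u * (star u * u)))‖ ≤ 1 := by
  have ha : IsSelfAdjoint (star u * u) := .star_mul_self u
  have key : u + c • (u * (star u * u - star u * u * (star u * u))) =
      u * cfc (fun s : ℝ ↦ 1 + c * (s - s * s)) (star u * u) := by
    rw [cfc_add _ _ _ (by fun_prop) (by fun_prop), cfc_const_mul _ _ _ (by fun_prop),
      cfc_sub _ _ _ (by fun_prop) (by fun_prop), cfc_mul _ _ _ (by fun_prop) (by fun_prop),
      cfc_id' ℝ _ ha, cfc_const_one ℝ _ ha, mul_add, mul_one, mul_smul_comm]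
  rw [key]
  refine norm_mul_cfc_le_one u (by fun_prop) fun s hs ↦ ?_
  have h0 := nonneg_of_mem_spectrum_star_mul_self u hs
  have h1 : s ≤ 1 := by
    have : Nontrivial B := by
      by_contra h
      rw [not_nontrivial_iff_subsingleton] at h
      simp [spectrum.of_subsingleton] at hs
    have h2 := spectrum.norm_le_norm_of_mem hs
    rw [CStarRing.norm_star_mul_self, Real.norm_of_nonneg h0] at h2
    nlinarith [norm_nonneg u]
  obtain ⟨hc1, hc2⟩ := abs_le.1 hc
  set t := √s with ht
  have hts : s = t * t := (Real.mul_self_sqrt h0).symm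
  have ht0 : 0 ≤ t := Real.sqrt_nonneg s
  have ht1 : t ≤ 1 := Real.sqrt_le_one.2 h1
  have hss : 0 ≤ s - s * s := by nlinarith
  have e : (1 + c * (s - s * s)) * (s * (1 + c * (s - s * s))) =
      (t * (1 + c * (s - s * s))) ^ 2 := by
    rw [hts]; ring
  have hpos : 0 ≤ 1 + c * (s - s * s) := by nlinarith
  rw [e, abs_of_nonneg (sq_nonneg _)]
  refine pow_le_one₀ (mul_nonneg ht0 hpos) ?_
  have h3 : 1 + c * (s - s * s) ≤ 1 + 1 / 2 * (s - s * s) := by nlinarith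
  refine (mul_le_mul_of_nonneg_left h3 ht0).trans ?_
  have h4 : t ^ 3 * (1 + t) ≤ 2 := by
    have : t ^ 3 ≤ 1 := pow_le_one₀ ht0 ht1
    nlinarith [pow_nonneg ht0 3]
  have h5 : 1 - t * (1 + 1 / 2 * (s - s * s)) = (1 - t) * (1 - t ^ 3 * (1 + t) / 2) := by
    rw [hts]; ring
  nlinarith [mul_nonneg (sub_nonneg.2 ht1) (by linarith : 0 ≤ 1 - t ^ 3 * (1 + t) / 2)]

lemma isPartialIsometry_of_mul_sub_sq_eq_zero {u : B}
    (h : u * (star u * u - star u * u * (star u * u)) = 0) : IsPartialIsometry u := by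
  have h1 : star u * u * (star u * u) * (star u * u) = star u * u * (star u * u) := by
    have := congrArg (star u * ·) h
    simp only [mul_sub, mul_zero, sub_eq_zero, ← mul_assoc] at this
    simp only [← mul_assoc]
    exact this.symm
  have h2 : star u * u * (star u * u) = star u * u := by
    rw [eq_comm, ← sub_eq_zero, ← CStarRing.star_mul_self_eq_zero_iff]
    simp only [star_sub, star_mul, star_star, sub_mul, mul_sub]
    simp only [← mul_assoc] at h1 ⊢
    simp only [h1, sub_self]
  unfold IsPartialIsometry
  rw [eq_comm, ← sub_eq_zero, ← CStarRing.star_mul_self_eq_zero_iff]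
  simp only [star_sub, star_mul, star_star, sub_mul, mul_sub]
  simp only [← mul_assoc] at h2 ⊢
  simp only [h2, sub_self]

/-- The cross terms of `(u + b)* (u + b)` vanish, and `b* b` lies under the projection `1 - u* u`.
-/
lemma norm_add_le_one_of_orthogonal {u b : B} (hu : IsPartialIsometry u) (hb : ‖b‖ ≤ 1)
    (h1 : star u * b = 0) (h2 : b * (star u * u) = 0) : ‖u + b‖ ≤ 1 := by
  let _ := CStarAlgebra.spectralOrder B
  let _ := CStarAlgebra.spectralOrderedRing B
  have h1' : star b * u = 0 := by simpa using congrArg star h1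
  have hbb : star b * b ≤ 1 := by
    rw [← CStarAlgebra.norm_le_one_iff_of_nonneg _ (star_mul_self_nonneg b),
      CStarRing.norm_star_mul_self]
    exact mul_le_one₀ hb (norm_nonneg _) hb
  have h2' : star u * u * star b = 0 := by simpa [mul_assoc] using congrArg star h2
  have hq : star u * u * (star u * u) = star u * u := by
    rw [mul_assoc, ← mul_assoc u, hu]
  have h3 := star_left_conjugate_le_conjugate hbb (1 - star u * u)
  have e1 : star (1 - star u * u) * (star b * b) * (1 - star u * u) = star b * b := by
    have : star b * b * (star u * u) = 0 := by rw [mul_assoc, h2, mul_zero]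
    have h' : star u * u * (star b * b) = 0 := by rw [← mul_assoc, h2', zero_mul]
    simp [sub_mul, mul_sub, this, h']
  have e2 : star (1 - star u * u) * 1 * (1 - star u * u) = 1 - star u * u := by
    simp [sub_mul, mul_sub, hq]
  rw [e1, e2] at h3
  have h4 : star (u + b) * (u + b) ≤ 1 := by
    rw [star_add, add_mul, mul_add, mul_add, h1, h1', add_zero, zero_add]
    exact le_sub_iff_add_le'.1 h3
  rw [← CStarAlgebra.norm_le_one_iff_of_nonneg _ (star_mul_self_nonneg _),
    CStarRing.norm_star_mul_self] at h4
  nlinarith [norm_nonneg (u + b)]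

/-- A partial isometry `u` with `(1 - u u*) B (1 - u* u) = 0` is an extreme point of the unit
ball. -/
lemma mem_extremalPartialIsometries_of_forall_mul_mul_eq_zero {u : B} (hu : IsPartialIsometry u)
    (h : ∀ a, (1 - u * star u) * a * (1 - star u * u) = 0) :
    u ∈ extremalPartialIsometries B := by
  let _ := CStarAlgebra.spectralOrder B
  let _ := CStarAlgebra.spectralOrderedRing B
  have hq : star u * u * (star u * u) = star u * u := by rw [mul_assoc, ← mul_assoc u, hu]
  have hle {x : B} (hx : ‖x‖ ≤ 1) : star x * x ≤ 1 := by
    rw [← CStarAlgebra.norm_le_one_iff_of_nonneg _ (star_mul_self_nonneg x),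
      CStarRing.norm_star_mul_self]
    exact mul_le_one₀ hx (norm_nonneg _) hx
  -- Strict convexity: `t s (x - y)* (x - y) ≤ 1 - v* v`, and compressing by the projection `v* v`
  -- kills the right side. It is used for `u` and for `u*`.
  have main {v x y : B} (hv : star v * v * (star v * v) = star v * v)
      (hx : ‖x‖ ≤ 1) (hy : ‖y‖ ≤ 1) {t s : ℝ} (ht : 0 < t) (hs : 0 < s) (hts : t + s = 1)
      (hxy : t • x + s • y = v) : (x - y) * (star v * v) = 0 := by
    have e : (t * s) • (star (x - y) * (x - y)) =
        t • (star x * x) + s • (star y * y) - star v * v := by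
      have hs' : s = 1 - t := by linarith
      subst hs'
      rw [← hxy]
      simp only [star_sub, star_add, star_smul, star_trivial, sub_mul, mul_sub, add_mul, mul_add,
        smul_mul_assoc, mul_smul_comm]
      module
    have h1 : (t * s) • (star (x - y) * (x - y)) ≤ 1 - star v * v := by
      rw [e]
      refine sub_le_sub_right ?_ _
      calc t • (star x * x) + s • (star y * y) ≤ t • (1 : B) + s • (1 : B) :=
            add_le_add (smul_le_smul_of_nonneg_left (hle hx) ht.le)
              (smul_le_smul_of_nonneg_left (hle hy) hs.le)
        _ = 1 := by rw [← add_smul, hts, one_smul]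
    have h2 := star_left_conjugate_le_conjugate h1 (star v * v)
    have e2 : star (star v * v) * (1 - star v * v) * (star v * v) = 0 := by
      simp [mul_sub, hv]
    have e3 : star (star v * v) * ((t * s) • (star (x - y) * (x - y))) * (star v * v) =
        (t * s) • (star ((x - y) * (star v * v)) * ((x - y) * (star v * v))) := by
      simp only [star_mul, mul_smul_comm, smul_mul_assoc, mul_assoc]
    rw [e2, e3] at h2
    have h3 := le_antisymm h2 (smul_nonneg (by positivity) (star_mul_self_nonneg _))
    rw [smul_eq_zero_iff_right (by positivity)] at h3
    exact (CStarRing.star_mul_self_eq_zero_iff _).1 h3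
  refine ⟨hu, ?_, ?_⟩
  · have : star u * u ≤ 1 := by
      have := star_mul_self_nonneg (1 - star u * u)
      simpa [sub_mul, mul_sub, hq] using this
    rw [← CStarAlgebra.norm_le_one_iff_of_nonneg _ (star_mul_self_nonneg u),
      CStarRing.norm_star_mul_self] at this
    rw [mem_closedBall_zero_iff]
    nlinarith [norm_nonneg u]
  · rintro x hx y hy ⟨t, s, ht, hs, hts, hxy⟩
    rw [mem_closedBall_zero_iff] at hx hy
    have h1 := main hq hx hy ht hs hts hxy
    have h2 : (star x - star y) * (star (star u) * star u) = 0 := by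
      refine main (v := star u) ?_ (by simpa using hx) (by simpa using hy) ht hs hts ?_
      · rw [star_star, ← mul_assoc, hu]
      · rw [← hxy]; simp
    have h2' : u * star u * (x - y) = 0 := by simpa using congrArg star h2
    have h3 := h (x - y)
    rw [mul_sub, mul_assoc _ (x - y) (star u * u), h1, mul_zero, mul_one, sub_zero, sub_mul,
      one_mul, h2',
      sub_zero] at h3
    have : x = y := sub_eq_zero.1 h3
    rw [← hxy, ← this, ← add_smul, hts, one_smul]

end Unital

/-! ### Kadison's theorem without a unit, and existence of the unit. -/

section NonUnital

variable {A : Type*} [NonUnitalCStarAlgebra A]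

lemma eq_zero_of_mem_unitBallExtremePoints {u d : A} (hu : u ∈ unitBallExtremePoints A)
    (h1 : ‖u + d‖ ≤ 1) (h2 : ‖u - d‖ ≤ 1) : d = 0 := by
  have := hu.2 (mem_closedBall_zero_iff.2 h1) (mem_closedBall_zero_iff.2 h2)
    ⟨1 / 2, 1 / 2, by norm_num, by norm_num, by norm_num, by module⟩
  simpa using this

lemma isPartialIsometry_of_mem_unitBallExtremePoints {u : A} (hu : u ∈ unitBallExtremePoints A) :
    IsPartialIsometry u := by
  have hn : ‖(u : Unitization ℂ A)‖ ≤ 1 := by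
    rw [Unitization.norm_inr]; exact mem_closedBall_zero_iff.1 hu.1
  have key (c : ℝ) (hc : |c| ≤ 1 / 2) :
      ‖u + c • (u * (star u * u - star u * u * (star u * u)))‖ ≤ 1 := by
    have := norm_add_mul_sub_sq_le_one hn hc
    rw [← Unitization.norm_inr (𝕜 := ℂ)]
    simpa using this
  have h1 := eq_zero_of_mem_unitBallExtremePoints hu (key (1 / 2) (by norm_num)) (by
    have := key (-(1 / 2)) (by norm_num)
    rwa [neg_smul, ← sub_eq_add_neg] at this)
  have h2 := (smul_eq_zero_iff_right (by norm_num)).1 h1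
  have h3 := congrArg (fun a : A ↦ (a : Unitization ℂ A)) h2
  have h4 := isPartialIsometry_of_mul_sub_sq_eq_zero (u := (u : Unitization ℂ A))
    (by simpa using h3)
  have h5 : ((u * star u * u : A) : Unitization ℂ A) = u := by simpa [IsPartialIsometry] using h4
  exact Unitization.inr_injective h5

lemma eq_zero_of_orthogonal_of_mem_unitBallExtremePoints {u b : A}
    (hu : u ∈ unitBallExtremePoints A) (h1 : star u * b = 0) (h2 : b * (star u * u) = 0) :
    b = 0 := by
  have hpi := isPartialIsometry_of_mem_unitBallExtremePoints hu
  have key (c : ℝ) (hc : ‖c • b‖ ≤ 1) : ‖u + c • b‖ ≤ 1 := by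
    have e1 : star (u : Unitization ℂ A) * ((c • b : A) : Unitization ℂ A) = 0 := by
      rw [← Unitization.inr_star, ← Unitization.inr_mul, mul_smul_comm, h1, smul_zero,
        Unitization.inr_zero]
    have e2 : ((c • b : A) : Unitization ℂ A) * (star (u : Unitization ℂ A) * u) = 0 := by
      rw [← Unitization.inr_star, ← Unitization.inr_mul, ← Unitization.inr_mul, smul_mul_assoc,
        h2, smul_zero, Unitization.inr_zero]
    have e3 : IsPartialIsometry (u : Unitization ℂ A) := by
      unfold IsPartialIsometry
      rw [← Unitization.inr_star, ← Unitization.inr_mul, ← Unitization.inr_mul, hpi]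
    have := norm_add_le_one_of_orthogonal e3 (by rwa [Unitization.norm_inr]) e1 e2
    rwa [← Unitization.inr_add, Unitization.norm_inr] at this
  by_contra hb
  have hb' : ‖b‖ ≠ 0 := norm_ne_zero_iff.2 hb
  have h3 := eq_zero_of_mem_unitBallExtremePoints hu
    (key ‖b‖⁻¹ (by simp [norm_smul, hb'])) (by
      have := key (-‖b‖⁻¹) (by simp [norm_smul, hb'])
      rwa [neg_smul, ← sub_eq_add_neg] at this)
  exact hb ((smul_eq_zero_iff_right (inv_ne_zero hb')).1 h3)

/-- Kadison: if `u` is an extreme point of the unit ball of `A`, then `(1 - u u*) A (1 - u* u) = 0`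
(the product is expanded, as `A` need not have a unit). -/
lemma eq_of_mem_unitBallExtremePoints {u : A} (hu : u ∈ unitBallExtremePoints A) (x : A) :
    x = u * star u * x + x * (star u * u) - u * star u * x * (star u * u) := by
  have hpi : u * star u * u = u := isPartialIsometry_of_mem_unitBallExtremePoints hu
  have hpi' : star u * u * star u = star u := by simpa [mul_assoc] using congrArg star hpi
  have hp (y : A) : star u * (u * (star u * y)) = star u * y := by
    rw [← mul_assoc u, ← mul_assoc, ← mul_assoc, hpi']
  have hq : star u * (u * (star u * u)) = star u * u := hp u
  have := eq_zero_of_orthogonal_of_mem_unitBallExtremePoints (u := u)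
    (b := x - (u * star u * x + x * (star u * u) - u * star u * x * (star u * u))) hu
    (by simp [mul_sub, mul_add, mul_assoc, hp]) (by simp [sub_mul, add_mul, mul_assoc, hq])
  exact sub_eq_zero.1 this

/-- Each term on the right of Kadison's relation converges along an approximate unit, which
therefore converges in norm; its limit is the unit. -/
lemma exists_unit_of_mem_unitBallExtremePoints {u : A} (hu : u ∈ unitBallExtremePoints A) :
    ∃ e : A, ∀ a : A, e * a = a ∧ a * e = a := by
  let _ := CStarAlgebra.spectralOrder A
  let _ := CStarAlgebra.spectralOrderedRing A
  have hl := CStarAlgebra.increasingApproximateUnit A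
  set l := CStarAlgebra.approximateUnit A
  set p := u * star u
  set q := star u * u
  have ht : Filter.Tendsto (fun x : A ↦ x) l (nhds (p + q - p * q)) := by
    have h := ((hl.tendsto_mul_left p).add (hl.tendsto_mul_right q)).sub
      ((hl.tendsto_mul_left p).mul_const q)
    exact h.congr fun x ↦ (eq_of_mem_unitBallExtremePoints hu x).symm
  refine ⟨p + q - p * q, fun a ↦ ⟨?_, ?_⟩⟩
  · exact tendsto_nhds_unique (ht.mul_const a) (hl.tendsto_mul_right a)
  · exact tendsto_nhds_unique (ht.const_mul a) (hl.tendsto_mul_left a)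

end NonUnital

/-- A C⋆-algebra with a unit element is a `CStarAlgebra`. -/
lemma exists_cstarAlgebra_of_unit {A : Type*} [inst : NonUnitalCStarAlgebra A] {e : A}
    (he : ∀ a : A, e * a = a ∧ a * e = a) :
    ∃ i : CStarAlgebra A, i.toNonUnitalCStarAlgebra = inst := by
  let r : NormedRing A :=
    { inst with
      one := e
      one_mul := fun a ↦ (he a).1
      mul_one := fun a ↦ (he a).2 }
  let al : Algebra ℂ A := Algebra.ofModule (fun c a b ↦ smul_mul_assoc c a b)
    (fun c a b ↦ mul_smul_comm c a b)
  let i : CStarAlgebra A :=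
    { r, inst, al with
      norm_smul_le := fun c a ↦ norm_smul_le c a }
  exact ⟨i, rfl⟩

/-! ### Polar parts near an extremal partial isometry, and the homotopy. -/

section Path

variable {B : Type*} [CStarAlgebra B]

/-- The function `s ↦ max(s, δ)^(-1/2)`. -/
noncomputable def truncatedInvSqrt (δ s : ℝ) : ℝ := (√(max s δ))⁻¹

lemma continuous_truncatedInvSqrt {δ : ℝ} (hδ : 0 < δ) : Continuous (truncatedInvSqrt δ) := by
  unfold truncatedInvSqrt
  refine Continuous.inv₀ (by fun_prop) fun s ↦ ?_
  exact (Real.sqrt_pos.2 (lt_max_of_lt_right hδ)).ne'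

lemma truncatedInvSqrt_mul_mul_self {δ s : ℝ} (hδ : 0 < δ) (hs : δ ≤ s) :
    truncatedInvSqrt δ s * (s * truncatedInvSqrt δ s) = 1 := by
  have h0 : 0 < s := hδ.trans_le hs
  have h1 : √s ≠ 0 := (Real.sqrt_pos.2 h0).ne'
  rw [truncatedInvSqrt, max_eq_left hs]
  field_simp
  exact (Real.sq_sqrt h0.le).symm

/-- The polar part of `x`, provided that `x* x` has no spectrum strictly between `0` and `δ`. -/
noncomputable def polarPart (δ : ℝ) (x : B) : B :=
  x * cfc (truncatedInvSqrt δ) (star x * x)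

lemma star_polarPart_mul_polarPart {δ : ℝ} (hδ : 0 < δ) (x : B) :
    star (polarPart δ x) * polarPart δ x =
      cfc (fun s ↦ truncatedInvSqrt δ s * (s * truncatedInvSqrt δ s)) (star x * x) :=
  star_mul_cfc_mul_mul_cfc x (continuous_truncatedInvSqrt hδ) (continuous_truncatedInvSqrt hδ)

variable {δ : ℝ} {x : B}

lemma mul_star_polarPart_mul_polarPart (hδ : 0 < δ)
    (hx : ∀ s ∈ spectrum ℝ (star x * x), s = 0 ∨ δ ≤ s) :
    x * (star (polarPart δ x) * polarPart δ x) = x := by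
  have hc := continuous_truncatedInvSqrt hδ
  rw [star_polarPart_mul_polarPart hδ, mul_cfc_congr x (g := fun _ ↦ 1) (by fun_prop) (by fun_prop),
    cfc_const_one ℝ _ (.star_mul_self _), mul_one]
  intro s hs h0
  exact truncatedInvSqrt_mul_mul_self hδ ((hx s hs).resolve_left h0)

lemma isPartialIsometry_polarPart (hδ : 0 < δ)
    (hx : ∀ s ∈ spectrum ℝ (star x * x), s = 0 ∨ δ ≤ s) : IsPartialIsometry (polarPart δ x) := by
  have hc := continuous_truncatedInvSqrt hδ
  unfold IsPartialIsometry
  rw [mul_assoc, star_polarPart_mul_polarPart hδ]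
  nth_rw 1 [polarPart]
  rw [mul_assoc, cfc_commute_cfc, ← mul_assoc, ← star_polarPart_mul_polarPart hδ,
    mul_star_polarPart_mul_polarPart hδ hx, polarPart]

lemma polarPart_mul_star_polarPart_mul (hδ : 0 < δ)
    (hx : ∀ s ∈ spectrum ℝ (star x * x), s = 0 ∨ δ ≤ s) :
    polarPart δ x * star (polarPart δ x) * x = x := by
  have hc := continuous_truncatedInvSqrt hδ
  have h : polarPart δ x * star (polarPart δ x) * x =
      x * (star (polarPart δ x) * polarPart δ x) := by
    rw [star_polarPart_mul_polarPart hδ,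
      cfc_mul _ (fun s ↦ s * truncatedInvSqrt δ s) _ hc.continuousOn (by fun_prop),
      cfc_mul (fun s ↦ s) _ _ (by fun_prop) hc.continuousOn, cfc_id' ℝ _ (.star_mul_self x)]
    have hcomm := cfc_commute_cfc (fun s : ℝ ↦ s) (truncatedInvSqrt δ) (star x * x)
    rw [cfc_id' ℝ _ (.star_mul_self x)] at hcomm
    rw [hcomm.eq, polarPart, star_mul,
      (cfc_predicate (truncatedInvSqrt δ) (star x * x)).star_eq]
    simp only [mul_assoc]
  rw [h, mul_star_polarPart_mul_polarPart hδ hx]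

/-- The spectrum of `u* u` lies in `{0, 1}`. This fixes the endpoints of the path. -/
lemma polarPart_of_isPartialIsometry {u : B} (hu : IsPartialIsometry u) (hδ : 0 < δ) (hδ1 : δ ≤ 1) :
    polarPart δ u = u := by
  have hq : star u * u * (star u * u) = star u * u := by rw [mul_assoc, ← mul_assoc u, hu]
  rw [polarPart, mul_cfc_congr u (g := fun _ ↦ 1) (continuous_truncatedInvSqrt hδ) (by fun_prop),
    cfc_const_one ℝ _ (.star_mul_self _), mul_one]
  intro s hs h0
  have h1 : s * s = s := by
    have hcs : cfc (fun s : ℝ ↦ s * s - s) (star u * u) = cfc (fun _ : ℝ ↦ 0) (star u * u) := by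
      rw [cfc_sub _ _ _ (by fun_prop) (by fun_prop), cfc_mul _ _ _ (by fun_prop) (by fun_prop),
        cfc_id' ℝ _ (.star_mul_self u), hq, sub_self, cfc_const_zero]
    have := (cfc_eq_cfc_iff_eqOn (.star_mul_self u) (by fun_prop) (by fun_prop)).1 hcs hs
    exact sub_eq_zero.1 this
  have h2 : s = 1 := mul_left_cancel₀ h0 (by rw [h1, mul_one])
  rw [h2, truncatedInvSqrt, max_eq_left hδ1]
  simp

/-- If `x` is von Neumann regular, then `0` is isolated in the spectrum of `x* x`. -/
lemma spectrum_gap_of_eq_mul_mul {x y : B} {M : ℝ} (hM : 0 < M) (hy : ‖y‖ ≤ M)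
    (hxy : x * y * x = x) : ∀ s ∈ spectrum ℝ (star x * x), s = 0 ∨ (M ^ 2)⁻¹ ≤ s := by
  let _ := CStarAlgebra.spectralOrder B
  let _ := CStarAlgebra.spectralOrderedRing B
  intro s hs
  have h0 := nonneg_of_mem_spectrum_star_mul_self x hs
  set a := star x * x with ha
  have hsa : IsSelfAdjoint a := .star_mul_self x
  have h1 : a * (y * x) = a := by rw [ha, mul_assoc, ← mul_assoc x, hxy]
  have h1' : star x * star y * a = a := by simpa [ha, mul_assoc] using congrArg star h1
  have h2 : star y * y ≤ algebraMap ℝ B (M ^ 2) :=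
    (CStarAlgebra.star_mul_le_algebraMap_norm_sq).trans
      (algebraMap_mono B (pow_le_pow_left₀ (norm_nonneg _) hy 2))
  have h3 : star x * (star y * y) * x ≤ M ^ 2 • a := by
    refine (star_left_conjugate_le_conjugate h2 x).trans_eq ?_
    rw [Algebra.algebraMap_eq_smul_one, ha]
    simp
  -- Since `a y x = a`, expanding this square and using `h3` gives `M⁴ a² - M² a ≥ 0`, hence `M² s
  -- (M² s - 1) ≥ 0` on the spectrum.
  have h4 : 0 ≤ star (M ^ 2 • a - y * x) * (M ^ 2 • a - y * x) := star_mul_self_nonneg _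
  have e : star (M ^ 2 • a - y * x) * (M ^ 2 • a - y * x) =
      M ^ 4 • (a * a) - (2 * M ^ 2) • a + star x * (star y * y) * x := by
    have : star x * (star y * y) * x = star x * star y * (y * x) := by simp only [mul_assoc]
    rw [this, star_sub, star_smul, star_trivial, hsa.star_eq, star_mul]
    simp only [sub_mul, mul_sub, smul_mul_assoc, mul_smul_comm, h1, h1']
    module
  have h5 : 0 ≤ M ^ 4 • (a * a) - M ^ 2 • a := by
    rw [e] at h4
    refine h4.trans ((add_le_add_right h3 _).trans_eq ?_)
    module
  have e2 : M ^ 4 • (a * a) - M ^ 2 • a = cfc (fun s : ℝ ↦ M ^ 4 * (s * s) - M ^ 2 * s) a := by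
    rw [cfc_sub _ _ _ (by fun_prop) (by fun_prop), cfc_const_mul _ _ _ (by fun_prop),
      cfc_const_mul _ _ _ (by fun_prop), cfc_mul _ _ _ (by fun_prop) (by fun_prop),
      cfc_id' ℝ _ hsa]
  rw [e2, cfc_nonneg_iff _ _ (by fun_prop)] at h5
  have h6 := h5 s hs
  rcases h0.eq_or_lt with h | h
  · exact .inl h.symm
  · right
    rw [inv_le_iff_one_le_mul₀ (by positivity)]
    have : 0 ≤ (M ^ 2 * s) * (s * M ^ 2 - 1) := by linarith
    have := nonneg_of_mul_nonneg_right this (by positivity)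
    linarith

/-- If `(1 - x y) B (1 - y x) = 0`, then the polar part of `x` is an extremal partial isometry. -/
lemma polarPart_mem_extremalPartialIsometries {x y : B} (hδ : 0 < δ)
    (hx : ∀ s ∈ spectrum ℝ (star x * x), s = 0 ∨ δ ≤ s)
    (hxy : ∀ a, (1 - x * y) * a * (1 - y * x) = 0) :
    polarPart δ x ∈ extremalPartialIsometries B := by
  refine mem_extremalPartialIsometries_of_forall_mul_mul_eq_zero
    (isPartialIsometry_polarPart hδ hx) fun a ↦ ?_
  set v := polarPart δ x
  have h1 : 1 - star v * v = (1 - y * x) * (1 - star v * v) := by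
    have : x * (1 - star v * v) = 0 := by
      rw [mul_sub, mul_one, mul_star_polarPart_mul_polarPart hδ hx, sub_self]
    rw [sub_mul, mul_assoc, this, mul_zero, sub_zero, one_mul]
  have h2 : 1 - v * star v = (1 - v * star v) * (1 - x * y) := by
    have : (1 - v * star v) * x = 0 := by
      rw [sub_mul, one_mul, polarPart_mul_star_polarPart_mul hδ hx, sub_self]
    rw [mul_sub, ← mul_assoc, this, zero_mul, sub_zero, mul_one]
  rw [h1, h2]
  calc _ = (1 - v * star v) * ((1 - x * y) * a * (1 - y * x)) * (1 - star v * v) := by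
        simp only [mul_assoc]
    _ = 0 := by rw [hxy, mul_zero, zero_mul]

/-- An element at distance less than `1` from an extremal partial isometry is quasi-invertible. -/
lemma exists_quasiInverse {u x : B} {r : ℝ} (hr : r < 1)
    (hu1 : ‖u‖ ≤ 1) (hu : ∀ a, (1 - u * star u) * a * (1 - star u * u) = 0) (hx : ‖x - u‖ ≤ r) :
    ∃ y : B, ‖y‖ ≤ (1 - r)⁻¹ ∧ ∀ a, (1 - x * y) * a * (1 - y * x) = 0 := by
  rcases subsingleton_or_nontrivial B with h | h
  · exact ⟨0, by simpa using hr.le, fun a ↦ Subsingleton.elim _ _⟩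
  set d := x - u with hd
  have hxd : x = u + d := by rw [hd]; abel
  have hr0 : 0 ≤ r := (norm_nonneg _).trans hx
  have hn : ‖star u * d‖ ≤ r := by
    refine (norm_mul_le _ _).trans ?_
    rw [norm_star]
    nlinarith [norm_nonneg u, norm_nonneg d]
  have hn' : ‖d * star u‖ ≤ r := by
    refine (norm_mul_le _ _).trans ?_
    rw [norm_star]
    nlinarith [norm_nonneg u, norm_nonneg d]
  obtain ⟨k, hk⟩ : IsUnit (1 + star u * d) := by
    simpa using isUnit_one_sub_of_norm_lt_one (x := -(star u * d)) (by rw [norm_neg]; linarith)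
  obtain ⟨m, hm⟩ : IsUnit (1 + d * star u) := by
    simpa using isUnit_one_sub_of_norm_lt_one (x := -(d * star u)) (by rw [norm_neg]; linarith)
  -- The two inverses are intertwined by `u*`, so one `y` serves on both sides.
  have hkm : (↑k⁻¹ : B) * star u = star u * ↑m⁻¹ := by
    rw [Units.inv_mul_eq_iff_eq_mul, ← mul_assoc, Units.eq_mul_inv_iff_mul_eq, hk, hm]
    simp only [mul_add, add_mul, mul_one, one_mul, mul_assoc]
  have hkn : ‖(↑k⁻¹ : B)‖ ≤ (1 - r)⁻¹ := by
    have h1 : (↑k⁻¹ : B) = 1 - star u * d * ↑k⁻¹ := by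
      have := k.mul_inv
      rw [hk, add_mul, one_mul] at this
      exact eq_sub_of_add_eq this
    have h2 : ‖(↑k⁻¹ : B)‖ ≤ 1 + r * ‖(↑k⁻¹ : B)‖ := by
      nth_rw 1 [h1]
      refine (norm_sub_le _ _).trans ?_
      rw [CStarRing.norm_one]
      refine add_le_add_right ((norm_mul_le _ _).trans ?_) _
      exact mul_le_mul_of_nonneg_right hn (norm_nonneg _)
    rw [← one_div (1 - r), le_div_iff₀ (by linarith)]
    linarith
  refine ⟨↑k⁻¹ * star u, ?_, fun a ↦ ?_⟩
  · refine (norm_mul_le _ _).trans ?_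
    rw [norm_star]
    exact (mul_le_of_le_one_right (norm_nonneg _) hu1).trans hkn
  · have e1 : 1 - ↑k⁻¹ * star u * x = ↑k⁻¹ * (1 - star u * u) := by
      have : star u * x = ↑k - (1 - star u * u) := by rw [hk, hxd, mul_add]; abel
      rw [mul_assoc, this, mul_sub, Units.inv_mul, sub_sub_cancel]
    have e2 : 1 - x * (↑k⁻¹ * star u) = (1 - u * star u) * ↑m⁻¹ := by
      have : x * star u = ↑m - (1 - u * star u) := by rw [hm, hxd, add_mul]; abel
      rw [hkm, ← mul_assoc, this, sub_mul, Units.mul_inv, sub_sub_cancel]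
    rw [e1, e2]
    calc _ = (1 - u * star u) * (↑m⁻¹ * a * ↑k⁻¹) * (1 - star u * u) := by simp only [mul_assoc]
      _ = 0 := hu _

/-- For `r < 1` there is a uniform `δ` such that the elements at distance at most `r` from an
extremal partial isometry have an extremal polar part with gap `δ`. -/
lemma exists_forall_polarPart_mem {r : ℝ} (hr : r < 1) :
    ∃ δ : ℝ, 0 < δ ∧ δ ≤ 1 ∧ ∀ u x : B, ‖u‖ ≤ 1 →
      (∀ a, (1 - u * star u) * a * (1 - star u * u) = 0) → ‖x - u‖ ≤ r →
      polarPart δ x ∈ extremalPartialIsometries B := by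
  set C := (1 - r)⁻¹ with hC
  have hC0 : 0 < C := inv_pos.2 (by linarith)
  -- A bound for `‖2 y - y x y‖` from `‖y‖ ≤ C` and `‖x‖ ≤ 1 + r`; the extra `1` ensures `δ ≤ 1`.
  set M := 2 * C + C * (1 + r) * C + 1 with hM
  rcases lt_or_ge r 0 with hr0 | hr0
  · exact ⟨1, one_pos, le_rfl, fun u x _ _ h ↦ absurd (norm_nonneg (x - u)) (by linarith)⟩
  have hM1 : 1 ≤ M := by
    have : 0 ≤ C * (1 + r) * C := by positivity
    linarith
  refine ⟨(M ^ 2)⁻¹, by positivity, inv_le_one_of_one_le₀ (one_le_pow₀ hM1), ?_⟩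
  intro u x hu1 hu hx
  obtain ⟨y, hy, hxy⟩ := exists_quasiInverse hr hu1 hu hx
  have hxn : ‖x‖ ≤ 1 + r := by
    calc ‖x‖ = ‖u + (x - u)‖ := by rw [add_sub_cancel]
      _ ≤ ‖u‖ + ‖x - u‖ := norm_add_le _ _
      _ ≤ 1 + r := add_le_add hu1 hx
  refine polarPart_mem_extremalPartialIsometries (by positivity)
    (spectrum_gap_of_eq_mul_mul (y := 2 • y - y * x * y) (by linarith) ?_ ?_) hxy
  · calc ‖2 • y - y * x * y‖ ≤ ‖2 • y‖ + ‖y * x * y‖ := norm_sub_le _ _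
      _ ≤ 2 * ‖y‖ + ‖y‖ * ‖x‖ * ‖y‖ := by
        refine add_le_add ?_ (norm_mul₃_le)
        rw [two_smul, two_mul]
        exact norm_add_le _ _
      _ ≤ 2 * C + C * (1 + r) * C := by gcongr
      _ ≤ M := by linarith
  -- Taking `a = x` gives `x (2 y - y x y) x = x`.
  · have h := hxy x
    rw [← sub_eq_zero, ← neg_eq_zero, ← h]
    simp only [mul_sub, sub_mul, mul_one, one_mul, two_smul, mul_add, add_mul, mul_assoc]
    abel

/-- With `δ` fixed, a single continuous function serves all `x`; hence the need for a uniform gap.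
-/
lemma continuous_polarPart (hδ : 0 < δ) : Continuous (polarPart δ : B → B) := by
  have hc := continuous_truncatedInvSqrt hδ
  refine continuous_id.mul (Continuous.cfc_of_mem_nhdsSet (s := Set.univ) _ Filter.univ_mem
    (by fun_prop) (fun x ↦ .star_mul_self x) hc.continuousOn)

lemma forall_mul_mul_eq_zero_of_mem_unitBallExtremePoints {u : B}
    (hu : u ∈ unitBallExtremePoints B) (a : B) : (1 - u * star u) * a * (1 - star u * u) = 0 := by
  have := sub_eq_zero.2 (eq_of_mem_unitBallExtremePoints hu a)
  rw [← this]
  simp only [mul_sub, sub_mul, mul_one, one_mul]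
  abel

lemma joinedIn_extremalPartialIsometries {u v : B} (hu : u ∈ unitBallExtremePoints B)
    (hv : v ∈ unitBallExtremePoints B) (huv : ‖u - v‖ < 2) :
    JoinedIn (extremalPartialIsometries B) u v := by
  obtain ⟨δ, hδ, hδ1, H⟩ := exists_forall_polarPart_mem (B := B) (r := ‖u - v‖ / 2) (by linarith)
  refine JoinedIn.ofLine (f := fun t : ℝ ↦ polarPart δ (u + t • (v - u)))
    ((continuous_polarPart hδ).comp (by fun_prop)).continuousOn ?_ ?_ ?_
  · simpa using polarPart_of_isPartialIsometry
      (isPartialIsometry_of_mem_unitBallExtremePoints hu) hδ hδ1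
  · simpa using polarPart_of_isPartialIsometry
      (isPartialIsometry_of_mem_unitBallExtremePoints hv) hδ hδ1
  · rintro _ ⟨t, ⟨ht0, ht1⟩, rfl⟩
    rcases le_total t (1 / 2) with h | h
    · refine H u _ (mem_closedBall_zero_iff.1 hu.1)
        (forall_mul_mul_eq_zero_of_mem_unitBallExtremePoints hu) ?_
      rw [add_sub_cancel_left, norm_smul, Real.norm_of_nonneg ht0, norm_sub_rev]
      nlinarith [norm_nonneg (u - v)]
    · refine H v _ (mem_closedBall_zero_iff.1 hv.1)
        (forall_mul_mul_eq_zero_of_mem_unitBallExtremePoints hv) ?_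
      have : u + t • (v - u) - v = (1 - t) • (u - v) := by module
      rw [this, norm_smul, Real.norm_of_nonneg (by linarith)]
      nlinarith [norm_nonneg (u - v)]

end Path

/-! ### Sharpness via a proper isometry. -/

section Sharpness

variable {B : Type*} [CStarAlgebra B]

lemma mem_extremalPartialIsometries_of_star_mul_self_eq_one {s : B} (hs : star s * s = 1) :
    s ∈ extremalPartialIsometries B :=
  mem_extremalPartialIsometries_of_forall_mul_mul_eq_zero
    (by rw [IsPartialIsometry, mul_assoc, hs, mul_one]) fun a ↦ by rw [hs, sub_self, mul_zero]

lemma IsPartialIsometry.isUnit_iff_mem_unitary {u : B} (hu : IsPartialIsometry u) :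
    IsUnit u ↔ u ∈ unitary B := by
  refine ⟨fun h ↦ ?_, fun h ↦ (Unitary.toUnits ⟨u, h⟩).isUnit⟩
  unfold IsPartialIsometry at hu
  rw [Unitary.mem_iff]
  refine ⟨h.mul_left_cancel ?_, h.mul_right_cancel ?_⟩
  · rw [← mul_assoc, hu, mul_one]
  · rw [hu, one_mul]

/-- The unitaries are clopen in the extremal partial isometries. -/
lemma mem_unitary_of_joinedIn {u v : B} (h : JoinedIn (extremalPartialIsometries B) u v)
    (hu : u ∈ unitary B) : v ∈ unitary B := by
  set γ := h.somePath
  have hiff (t : unitInterval) : IsUnit (γ t) ↔ γ t ∈ unitary B :=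
    (h.somePath_mem t).1.isUnit_iff_mem_unitary
  -- Unitarity is a closed condition; for partial isometries it equals invertibility, which is open.
  have hclopen : IsClopen {t | γ t ∈ unitary B} := by
    refine ⟨(isClosed_unitary (R := B)).preimage γ.continuous, ?_⟩
    have : {t | γ t ∈ unitary B} = γ ⁻¹' {b | IsUnit b} := by
      ext t; exact (hiff t).symm
    rw [this]
    exact Units.isOpen.preimage γ.continuous
  have huniv := hclopen.eq_univ ⟨0, by simpa using hu⟩
  have h1 : (1 : unitInterval) ∈ {t | γ t ∈ unitary B} := huniv ▸ Set.mem_univ _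
  simpa using h1

/-- The unit and a proper isometry are at distance exactly `2` and are not homotopic. -/
lemma norm_one_sub_and_not_joinedIn_of_isometry {s : B} (hs : star s * s = 1)
    (hs' : s * star s ≠ 1) :
    ‖1 - s‖ = 2 ∧ ¬ JoinedIn (extremalPartialIsometries B) 1 s := by
  have h1 : (1 : B) ∈ extremalPartialIsometries B :=
    mem_extremalPartialIsometries_of_star_mul_self_eq_one (by simp)
  have h2 := mem_extremalPartialIsometries_of_star_mul_self_eq_one hs
  have hnot : ¬ JoinedIn (extremalPartialIsometries B) 1 s := fun h ↦
    hs' (Unitary.mem_iff.1 (mem_unitary_of_joinedIn h (one_mem _))).2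
  refine ⟨le_antisymm ?_ ?_, hnot⟩
  · calc ‖1 - s‖ ≤ ‖(1 : B)‖ + ‖s‖ := norm_sub_le _ _
      _ ≤ 1 + 1 := add_le_add (mem_closedBall_zero_iff.1 h1.2.1) (mem_closedBall_zero_iff.1 h2.2.1)
      _ = 2 := by norm_num
  -- A distance below `2` would yield a homotopy by the first part.
  · by_contra! h
    exact hnot (joinedIn_extremalPartialIsometries h1.2 h2.2 h)

end Sharpness

/-- There is a C⋆-algebra with a proper isometry, e.g. the unilateral shift. -/
lemma exists_proper_isometry :
    ∃ (B : Type w) (_ : CStarAlgebra B) (s : B), star s * s = 1 ∧ s * star s ≠ 1 := by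
  let H := lp (fun _ : ULift.{w} ℕ ↦ ℂ) 2
  let b : HilbertBasis (ULift.{w} ℕ) ℂ H := ⟨LinearIsometryEquiv.refl ℂ H⟩
  let σ : ULift.{w} ℕ → ULift.{w} ℕ := fun n ↦ ⟨n.down + 1⟩
  have hσ : Function.Injective σ := by
    rintro ⟨m⟩ ⟨n⟩ h
    simpa [σ] using h
  have ho : Orthonormal ℂ (b ∘ σ) := b.orthonormal.comp σ hσ
  let S : H →ₗᵢ[ℂ] H := ho.orthogonalFamily.linearIsometry
  -- The range of the shift is orthogonal to the first basis vector, so `S S* ≠ 1`.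
  have hS (f : H) : inner ℂ (b ⟨0⟩) (S f) = 0 := by
    have := (ho.orthogonalFamily.hasSum_linearIsometry f).mapL (innerSL ℂ (b ⟨0⟩))
    refine this.unique ?_
    convert hasSum_zero with i
    have : inner ℂ (b ⟨0⟩) (b (σ i)) = 0 := b.orthonormal.2 (by simp [σ, ULift.ext_iff])
    simp [this]
  refine ⟨H →L[ℂ] H, inferInstance, S.toContinuousLinearMap, ?_, ?_⟩
  · rw [ContinuousLinearMap.star_eq_adjoint]
    ext1 x
    refine ext_inner_left ℂ fun y ↦ ?_
    rw [mul_apply_eq_comp, ContinuousLinearMap.adjoint_inner_right]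
    exact S.inner_map_map y x
  · intro h
    have h1 := congrArg (fun T : H →L[ℂ] H ↦ inner ℂ (b ⟨0⟩) (T (b ⟨0⟩))) h
    have h2 : inner ℂ (b ⟨0⟩) (b ⟨0⟩) = (1 : ℂ) := by
      rw [inner_self_eq_norm_sq_to_K, b.orthonormal.1]; norm_num
    simp only [mul_apply_eq_comp, one_apply_eq_self, h2] at h1
    exact zero_ne_one ((hS _).symm.trans h1)

theorem theorem5 :
    (∀ (A : Type w) [NonUnitalCStarAlgebra A] (u v : A),
      u ∈ unitBallExtremePoints A → v ∈ unitBallExtremePoints A → ‖u - v‖ < 2 →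
        (∃ e : A, ∀ a : A, e * a = a ∧ a * e = a) ∧
        JoinedIn (extremalPartialIsometries A) u v) ∧
    (∃ (B : Type w) (_ : CStarAlgebra B) (u v : B),
      u ∈ extremalPartialIsometries B ∧ v ∈ extremalPartialIsometries B ∧ ‖u - v‖ = 2 ∧
        ¬ JoinedIn (extremalPartialIsometries B) u v) := by
  refine ⟨fun A inst u v hu hv huv ↦ ?_, ?_⟩
  · obtain ⟨e, he⟩ := exists_unit_of_mem_unitBallExtremePoints hu
    refine ⟨⟨e, he⟩, ?_⟩
    -- The unital structure extends the given one, so norm and extreme points are unchanged.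
    obtain ⟨i, rfl⟩ := exists_cstarAlgebra_of_unit he
    exact joinedIn_extremalPartialIsometries hu hv huv
  · obtain ⟨B, i, s, hs, hs'⟩ := exists_proper_isometry.{w}
    exact ⟨B, i, 1, s, mem_extremalPartialIsometries_of_star_mul_self_eq_one (by simp),
      mem_extremalPartialIsometries_of_star_mul_self_eq_one hs,
      norm_one_sub_and_not_joinedIn_of_isometry hs hs'⟩
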